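/- Let $X$ be an arbitrary topological space (no separation axioms are assumed). For a cardinal $\kappa$, $X$ is called $\kappa$-resolvable if it contains $\kappa$ many pairwise disjoint dense subsets. The dispersion character $\Delta(X)$ is the smallest cardinality of a nonempty open subset of $X$ (with $\Delta(\emptyset)=0$), and $X$ is called maximally resolvable if it is $\Delta(X)$-resolvable. The spread $s(X)$ is the maximum of $\aleph_0$ and the supremum of the cardinalities of the discrete subspaces of $X$. Let $\widehat{s}(X)$ be the smallest uncountable cardinal $\mu$ such that $X$ has no discrete subspace of cardinality $\mu$, and let $\operatorname{rs}(X)$ be the smallest uncountable regular cardinal $\mu$ such that $X$ has no discrete subspace of cardinality $\mu$. Theorem. (1) If $\kappa$ is a regular cardinal with $\widehat{s}(X)\le\kappa\le\Delta(X)$, then $X$ is $\kappa$-resolvable. (2) Consequently, if $\Delta(X)\ge\operatorname{rs}(X)$, then $X$ is maximally resolvable. (3) In particular, if $s(X)\le\aleph_0$ and $\Delta(X)>\aleph_0$, then $X$ is maximally resolvable. -/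

import Mathlib

open Cardinal

universe u

noncomputable section

/-- `X` is `κ`-resolvable: it contains `κ` many pairwise disjoint dense subsets. -/
def IsResolvable (κ : Cardinal.{u}) (X : Type u) [TopologicalSpace X] : Prop :=
  ∃ D : Set (Set X), #D = κ ∧ D.PairwiseDisjoint id ∧ ∀ A ∈ D, Dense A

/-- The dispersion character `Δ(X)`: the smallest cardinality of a nonempty open set
(a genuine minimum when `X` is nonempty, and `0` by convention when `X` is empty). -/
def dispersionCharacter (X : Type u) [TopologicalSpace X] : Cardinal.{u} :=
  sInf {μ | ∃ G : Set X, IsOpen G ∧ G.Nonempty ∧ #G = μ}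

/-- `X` is maximally resolvable: it is `Δ(X)`-resolvable. -/
def IsMaximallyResolvable (X : Type u) [TopologicalSpace X] : Prop :=
  IsResolvable (dispersionCharacter X) X

/-- `X` has a discrete subset (discrete in the subspace topology) of cardinality `μ`. -/
def HasDiscreteSubsetOfCard (X : Type u) [TopologicalSpace X] (μ : Cardinal.{u}) : Prop :=
  ∃ S : Set X, IsDiscrete S ∧ #S = μ

/-- The spread `s(X)`: the supremum of the cardinalities of the discrete subsets of `X`,
taken to be at least `ℵ₀` as is usual for cardinal functions. -/
def spread (X : Type u) [TopologicalSpace X] : Cardinal.{u} :=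
  max ℵ₀ (sSup {μ | HasDiscreteSubsetOfCard X μ})

/-- The cardinal `ŝ(X)`: the smallest uncountable cardinal `μ` such that `X` has no discrete
subset of cardinality `μ`. -/
def spreadHat (X : Type u) [TopologicalSpace X] : Cardinal.{u} :=
  sInf {μ | ℵ₀ < μ ∧ ¬ HasDiscreteSubsetOfCard X μ}

/-- The cardinal `rs(X)`: the smallest uncountable regular cardinal `μ` such that `X` has no
discrete subset of cardinality `μ`. -/
def regularSpread (X : Type u) [TopologicalSpace X] : Cardinal.{u} :=
  sInf {μ | ℵ₀ < μ ∧ μ.IsRegular ∧ ¬ HasDiscreteSubsetOfCard X μ}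

end

/-! Dense colourings glue over arbitrary unions, so it suffices to find, inside each nonempty open
set, one nonempty set with a dense colouring.

Regular `κ`: if an open `G` contains no left separated `κ`-sequence, every `G \ A` with `#A < κ` has
a dense subset of size below `κ`, and `κ` disjoint dense sets are picked recursively. Otherwise the
clubs `closurePoints f` act on the indices of such a sequence. As no discrete set has size `κ`, club
many terms are limits of nonstationary pieces of every club; `κ` disjoint pieces are coloured
(`IsLeftSeparated.exists_hasDenseColoring`).

Singular `μ = Δ(X)`: the main case is `#G = μ`. Points obstructed at `ν` have a dense subset of size
at most `ν`, so an open set covered by few obstructed sets is `μ`-colourable. If nothing in `G` is,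
`cof μ` stages yield disjoint sets, with more and more colours, accumulating at unobstructed points;
every nonempty open subset of `G` meets them at arbitrarily late stages. -/

/-! ### Gluing dense colourings -/

section Colorings

open Set

variable {X : Type u} [TopologicalSpace X]

/-- `S` can be coloured with `κ` colours in such a way that every colour class is dense in `S`. -/
def HasDenseColoring (κ : Cardinal.{u}) (S : Set X) : Prop :=
  ∃ c : X → Ordinal.{u}, ∀ ξ < κ.ord, S ⊆ closure (S ∩ c ⁻¹' {ξ})

theorem HasDenseColoring.mono {κ μ : Cardinal.{u}} {S : Set X} (h : HasDenseColoring κ S)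
    (hμ : μ ≤ κ) : HasDenseColoring μ S := by
  obtain ⟨c, hc⟩ := h
  exact ⟨c, fun ξ hξ => hc ξ (hξ.trans_le (ord_le_ord.2 hμ))⟩

theorem hasDenseColoring_empty (κ : Cardinal.{u}) : HasDenseColoring κ (∅ : Set X) :=
  ⟨fun _ => 0, fun _ _ => empty_subset _⟩

/-- Well-order the index set and colour each point by the first set containing it. -/
theorem HasDenseColoring.iUnion {ι : Type*} {κ : Cardinal.{u}} {S : ι → Set X}
    (h : ∀ t, HasDenseColoring κ (S t)) : HasDenseColoring κ (⋃ t, S t) := by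
  classical
  choose c hc using h
  rcases isEmpty_or_nonempty ι with _ | _
  · rw [iUnion_of_empty]
    exact hasDenseColoring_empty κ
  obtain ⟨_, _⟩ := exists_wellFoundedLT ι
  have hex : ∀ x ∈ ⋃ t, S t, ∃ t, x ∈ S t ∧ ∀ s < t, x ∉ S s := by
    intro x hx
    obtain ⟨t, ht⟩ := mem_iUnion.1 hx
    obtain ⟨m, hm, hmin⟩ := (wellFounded_lt (α := ι)).has_min {t | x ∈ S t} ⟨t, ht⟩
    exact ⟨m, hm, fun s hs hxs => hmin s hxs hs⟩
  choose! t ht using hex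
  refine ⟨fun x => if x ∈ ⋃ t, S t then c (t x) x else 0, fun ξ hξ x hx =>
    mem_closure_iff.2 fun U hU hxU => ?_⟩
  obtain ⟨s, hxs⟩ := mem_iUnion.1 hx
  -- For the least `m` with `S m` meeting `U`, every point of `U ∩ S m` is coloured by `c m`.
  obtain ⟨m, ⟨p, hpU, hpm⟩, hmin⟩ := (wellFounded_lt (α := ι)).has_min
    {t | (U ∩ S t).Nonempty} ⟨s, x, hxU, hxs⟩
  obtain ⟨q, hqU, hqm, hqc⟩ := mem_closure_iff.1 (hc m ξ hξ hpm) U hU hpU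
  have hq : q ∈ ⋃ t, S t := mem_iUnion.2 ⟨m, hqm⟩
  have : t q = m := by
    refine le_antisymm (not_lt.1 fun hlt => (ht q hq).2 m hlt hqm) (not_lt.1 fun hlt => ?_)
    exact hmin (t q) ⟨q, hqU, (ht q hq).1⟩ hlt
  refine ⟨q, hqU, hq, ?_⟩
  simp only [mem_preimage, hq, if_true, this]
  exact hqc

/-- The union of all colourable sets is colourable and, by hypothesis, dense. -/
theorem HasDenseColoring.univ_of_forall_isOpen {κ : Cardinal.{u}}
    (h : ∀ G : Set X, IsOpen G → G.Nonempty → ∃ S ⊆ G, S.Nonempty ∧ HasDenseColoring κ S) :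
    HasDenseColoring κ (univ : Set X) := by
  obtain ⟨c, hc⟩ := HasDenseColoring.iUnion
    (S := fun t : {S : Set X // HasDenseColoring κ S} => t.1) fun t => t.2
  refine ⟨c, fun ξ hξ x _ => mem_closure_iff.2 fun U hU hxU => ?_⟩
  obtain ⟨S, hSU, ⟨p, hp⟩, hS⟩ := h U hU ⟨x, hxU⟩
  obtain ⟨q, hqU, -, hqc⟩ := mem_closure_iff.1 (hc ξ hξ (mem_iUnion.2 ⟨⟨S, hS⟩, hp⟩)) U hU (hSU hp)
  exact ⟨q, hqU, mem_univ _, hqc⟩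

theorem HasDenseColoring.isResolvable [Nonempty X] {κ : Cardinal.{u}}
    (h : HasDenseColoring κ (univ : Set X)) : IsResolvable κ X := by
  obtain ⟨c, hc⟩ := h
  have hd : ∀ ξ < κ.ord, Dense (c ⁻¹' {ξ}) := fun ξ hξ x => by
    simpa using hc ξ hξ (mem_univ x)
  let D : κ.ord.ToType → Set X := fun i => c ⁻¹' {(i : Ordinal)}
  have hD : ∀ i, Dense (D i) := fun i => hd _ i.toOrd.2
  have hinj : ∀ i j, ¬ Disjoint (D i) (D j) → i = j := by
    intro i j hij
    obtain ⟨x, hxi, hxj⟩ := not_disjoint_iff.1 hij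
    have : (i : Ordinal) = j := (mem_singleton_iff.1 hxi).symm.trans (mem_singleton_iff.1 hxj)
    exact Ordinal.ToType.mk.symm.injective (Subtype.ext this)
  refine ⟨range D, ?_, ?_, ?_⟩
  · rw [mk_range_eq D, mk_ord_toType]
    intro i j hij
    refine hinj i j ?_
    rw [hij, disjoint_self]
    exact (hD j).nonempty.ne_empty
  · rintro _ ⟨i, rfl⟩ _ ⟨j, rfl⟩ hne
    by_contra hdis
    exact hne (congrArg D (hinj i j hdis))
  · rintro _ ⟨i, rfl⟩
    exact hD i

end Colorings

/-! ### Clubs on a regular uncountable cardinal -/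

section Indices

open Set

/-- The properties of a regular uncountable cardinal, regarded as a linear order. -/
structure IsRegularIndex (I : Type u) [LinearOrder I] : Prop where
  aleph0_lt : ℵ₀ < #I
  mk_Iic_lt : ∀ a : I, #(Iic a) < #I
  exists_gt : ∀ s : Set I, #s < #I → ∃ b, ∀ x ∈ s, x < b

theorem Cardinal.IsRegular.isRegularIndex {κ : Cardinal.{u}} (hκ : κ.IsRegular) (h : ℵ₀ < κ) :
    IsRegularIndex κ.ord.ToType where
  aleph0_lt := by rwa [mk_ord_toType]
  mk_Iic_lt a := by
    have h1 : #(Iio a) < #κ.ord.ToType := mk_Iio_lt a (by simp)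
    rw [← Iio_insert]
    refine (mk_insert_le).trans_lt (add_lt_of_lt ?_ h1 ?_)
    · rw [mk_ord_toType]; exact h.le
    · rw [mk_ord_toType]; exact one_lt_aleph0.trans h
  exists_gt s hs := by
    rw [mk_ord_toType] at hs
    have h1 : ⨆ x : s, ((x.1 : Ordinal.{u}) + 1) < κ.ord :=
      Ordinal.iSup_add_one_lt_of_lt_cof (by rwa [hκ.cof_ord]) fun x => x.1.toOrd.2
    refine ⟨Ordinal.ToType.mk ⟨_, h1⟩, fun x hx => ?_⟩
    rw [← OrderIso.symm_apply_lt]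
    refine Subtype.mk_lt_mk.2 ?_
    have := Ordinal.le_iSup (fun x : s => ((x.1 : Ordinal.{u}) + 1)) ⟨x, hx⟩
    exact (lt_add_one _).trans_le this

variable {I : Type u} [LinearOrder I]

/-- The set of non-minimal closure points of a function. -/
def closurePoints (f : I → I) : Set I := {δ | (∃ β, β < δ) ∧ ∀ β < δ, f β < δ}

theorem closurePoints_anti {f g : I → I} (h : f ≤ g) : closurePoints g ⊆ closurePoints f :=
  fun _ hδ => ⟨hδ.1, fun β hβ => (h β).trans_lt (hδ.2 β hβ)⟩

theorem lt_of_mem_closurePoints {f : I → I} {a δ : I} (h : ∀ β, a ≤ f β)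
    (hδ : δ ∈ closurePoints f) : a < δ := by
  obtain ⟨⟨β, hβ⟩, h2⟩ := hδ
  exact (h β).trans_lt (h2 β hβ)

namespace IsRegularIndex

theorem exists_gt_of_mk_lt (hI : IsRegularIndex I) {ι : Type u} (hι : #ι < #I) (f : ι → I) : ∃ b, ∀ i, f i < b := by
  obtain ⟨b, hb⟩ := hI.exists_gt (range f) (mk_range_le.trans_lt hι)
  exact ⟨b, fun i => hb _ ⟨i, rfl⟩⟩

theorem exists_mem_closurePoints [WellFoundedLT I] (hI : IsRegularIndex I) (f : I → I) (a : I) :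
    ∃ δ ∈ closurePoints f, a < δ := by
  have h1 : ∀ a : I, ∃ b, a < b ∧ ∀ β ≤ a, f β < b := by
    intro a
    obtain ⟨b, hb⟩ := hI.exists_gt_of_mk_lt (hI.mk_Iic_lt a) fun x => max a (f x.1)
    exact ⟨b, (le_max_left _ _).trans_lt (hb ⟨a, le_refl a⟩),
      fun β hβ => (le_max_right _ _).trans_lt (hb ⟨β, hβ⟩)⟩
  choose g hg using h1
  let s : ℕ → I := fun n => g^[n] a
  obtain ⟨b, hb⟩ := hI.exists_gt (range s) ((countable_range s).le_aleph0.trans_lt hI.aleph0_lt)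
  -- The least strict upper bound of the `ω` iterates is a closure point.
  obtain ⟨δ, hδ, hmin⟩ := (wellFounded_lt (α := I)).has_min {b | ∀ n, s n < b}
    ⟨b, fun n => hb _ ⟨n, rfl⟩⟩
  refine ⟨δ, ⟨⟨a, hδ 0⟩, fun β hβ => ?_⟩, hδ 0⟩
  have : ∃ n, β ≤ s n := by
    by_contra! hcon
    exact hmin β hcon hβ
  obtain ⟨n, hn⟩ := this
  refine ((hg (s n)).2 β hn).trans ?_
  have h3 : s (n + 1) = g (s n) := Function.iterate_succ_apply' g n a
  exact h3 ▸ hδ (n + 1)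

theorem exists_forall_closurePoints_subset (hI : IsRegularIndex I) {ι : Type u} (hι : #ι < #I) (f : ι → I → I) :
    ∃ h : I → I, ∀ i, closurePoints h ⊆ closurePoints (f i) := by
  choose h hh using fun β => hI.exists_gt_of_mk_lt hι fun i => f i β
  exact ⟨h, fun i => closurePoints_anti fun β => (hh β i).le⟩

/-- Diagonal intersection of clubs: `h γ` bounds all `f x β` with `x, β ≤ γ`. -/
theorem exists_diagonal (hI : IsRegularIndex I) (f : I → I → I) :
    ∃ h : I → I, ∀ δ ∈ closurePoints h, ∀ x < δ, δ ∈ closurePoints (f x) := by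
  have h1 : ∀ γ : I, ∃ b, ∀ x ≤ γ, ∀ β ≤ γ, f x β < b := by
    intro γ
    obtain ⟨b, hb⟩ := hI.exists_gt_of_mk_lt (ι := Iic γ × Iic γ) (by
      rw [mk_prod]; simp only [lift_id]
      exact mul_lt_of_lt hI.aleph0_lt.le (hI.mk_Iic_lt γ) (hI.mk_Iic_lt γ)) fun p => f p.1 p.2
    exact ⟨b, fun x hx β hβ => hb (⟨x, hx⟩, ⟨β, hβ⟩)⟩
  choose h hh using h1
  refine ⟨h, fun δ hδ x hx => ⟨hδ.1, fun β hβ => ?_⟩⟩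
  exact (hh (max x β) x (le_max_left _ _) β (le_max_right _ _)).trans (hδ.2 _ (max_lt hx hβ))

theorem mk_eq_of_forall_exists_gt (hI : IsRegularIndex I) {s : Set I} (hs : ∀ a, ∃ x ∈ s, a < x) : #s = #I := by
  refine (mk_set_le s).antisymm (not_lt.1 fun hlt => ?_)
  obtain ⟨b, hb⟩ := hI.exists_gt s hlt
  obtain ⟨x, hx, hbx⟩ := hs b
  exact (hb x hx).not_gt hbx

theorem exists_mem_gt_of_mk_eq (hI : IsRegularIndex I) {s : Set I} (hs : #s = #I) (a : I) : ∃ x ∈ s, a < x := by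
  by_contra! h
  exact ((mk_le_mk_of_subset (fun x hx => h x hx : s ⊆ Iic a)).trans_lt (hI.mk_Iic_lt a)).ne hs

end IsRegularIndex

end Indices

/-! ### Left separated sequences without large discrete subsets -/

section LeftSeparated

open Set

variable {X : Type u} [TopologicalSpace X] {I : Type u} [LinearOrder I]

/-- A left separated transfinite sequence: no term is in the closure of the earlier ones. -/
def IsLeftSeparated (y : I → X) : Prop := ∀ a, y a ∉ closure (y '' Iio a)

theorem IsLeftSeparated.injective {y : I → X} (hy : IsLeftSeparated y) : Function.Injective y := by
  intro a b hab
  rcases lt_trichotomy a b with h | h | h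
  · exact absurd (hab ▸ subset_closure (mem_image_of_mem y h)) (hy b)
  · exact h
  · exact absurd (hab ▸ subset_closure (mem_image_of_mem y h)) (hy a)

theorem isDiscrete_of_notMem_closure_diff {S : Set X} (h : ∀ x ∈ S, x ∉ closure (S \ {x})) :
    IsDiscrete S := by
  refine IsDiscrete.of_nhdsWithin fun x hx s hs => ?_
  have h1 := h x hx
  rw [mem_closure_iff_nhdsWithin_neBot, Filter.not_neBot] at h1
  have h2 : insert x (S \ {x}) = S := by simp [hx]
  rw [← h2, nhdsWithin_insert, h1, sup_bot_eq]
  exact hs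

/-- Where a left separated sequence is not a limit of nonstationary subsets of a given club. -/
def isolatedIndices (y : I → X) : Set I :=
  {x | ∃ f : I → I, ∀ g : I → I, y x ∉ closure (y '' (closurePoints f \ closurePoints g))}

/-- Were the isolated indices unbounded in the diagonal intersection of their witnessing clubs, a
sparse unbounded set of them would give a discrete set: left separation handles earlier terms, the
witnessing club later ones. -/
theorem IsLeftSeparated.exists_closurePoints_disjoint_isolatedIndices {y : I → X}
    (hy : IsLeftSeparated y) (hI : IsRegularIndex I) (hX : ¬ HasDiscreteSubsetOfCard X #I) :
    ∃ h : I → I, ∀ δ ∈ closurePoints h, δ ∉ isolatedIndices y := by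
  classical
  have h1 : ∀ x, ∃ f : I → I, x ∈ isolatedIndices y →
      ∀ g : I → I, y x ∉ closure (y '' (closurePoints f \ closurePoints g)) := by
    intro x
    by_cases hx : x ∈ isolatedIndices y
    · obtain ⟨f, hf⟩ := hx
      exact ⟨f, fun _ => hf⟩
    · exact ⟨id, fun h => absurd h hx⟩
  choose f hf using h1
  obtain ⟨h0, hh0⟩ := hI.exists_diagonal f
  have hbd : ∃ a, ∀ x ∈ isolatedIndices y ∩ closurePoints h0, x ≤ a := by
    by_contra! hcon
    choose g hg hgt using hcon
    -- Since `β < g β`, no value of `g` is a closure point of `g`, so `range g` is nonstationary.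
    have hB : range g ⊆ closurePoints h0 \ closurePoints g := by
      rintro _ ⟨β, rfl⟩
      exact ⟨(hg β).2, fun hmem => lt_irrefl _ (hmem.2 β (hgt β))⟩
    refine hX ⟨y '' range g, isDiscrete_of_notMem_closure_diff ?_, ?_⟩
    · rintro _ ⟨_, ⟨β, rfl⟩, rfl⟩
      set x := g β with hx
      have hsub : y '' range g \ {y x} ⊆
          y '' Iio x ∪ y '' (closurePoints (f x) \ closurePoints g) := by
        rintro _ ⟨⟨z, hz, rfl⟩, hzx⟩
        rcases lt_trichotomy z x with hlt | heq | hlt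
        · exact Or.inl ⟨z, hlt, rfl⟩
        · exact absurd (congrArg y heq) hzx
        · exact Or.inr ⟨z, ⟨hh0 z (hB hz).1 x hlt, (hB hz).2⟩, rfl⟩
      intro hmem
      have := closure_mono hsub hmem
      rw [closure_union] at this
      exact this.elim (hy x) (hf x (hg β).1 g)
    · rw [mk_image_eq hy.injective]
      exact hI.mk_eq_of_forall_exists_gt fun a => ⟨g a, ⟨a, rfl⟩, hgt a⟩
  obtain ⟨a, ha⟩ := hbd
  refine ⟨fun β => max (h0 β) a, fun δ hδ hδi => ?_⟩
  have h2 := closurePoints_anti (f := h0) (fun β => le_max_left _ _) hδ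
  exact (ha δ ⟨hδi, h2⟩).not_gt (lt_of_mem_closurePoints (fun β => le_max_right _ _) hδ)

/-- Recursion on `a`: the next club lies inside all earlier `closurePoints (g b)`, which makes the
pieces disjoint. Fewer than `#I` indices `x ≤ a` are served by one `g a`. -/
theorem IsRegularIndex.exists_seq_closurePoints [WellFoundedLT I] (hI : IsRegularIndex I)
    (y : I → X) (h : I → I) :
    ∃ f g : I → I → I, (∀ a b, a < b → closurePoints (f b) ⊆ closurePoints (g a)) ∧
      (∀ a, closurePoints (f a) ⊆ closurePoints h ∩ Ioi a) ∧
      ∀ a, ∀ x ≤ a, x ∉ isolatedIndices y →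
        y x ∈ closure (y '' (closurePoints (f a) \ closurePoints (g a))) := by
  have hF : ∀ a : I, ∀ p : (b : I) → b < a → I → I, ∃ f : I → I,
      (∀ b hb, closurePoints f ⊆ closurePoints (p b hb)) ∧
        closurePoints f ⊆ closurePoints h ∩ Ioi a := by
    intro a p
    obtain ⟨f, hf⟩ := hI.exists_forall_closurePoints_subset
      (ι := Iio a) ((mk_le_mk_of_subset Iio_subset_Iic_self).trans_lt (hI.mk_Iic_lt a))
      fun b => p b.1 b.2
    refine ⟨fun β => max (f β) (max (h β) a), fun b hb => ?_, fun δ hδ => ⟨?_, ?_⟩⟩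
    · exact (closurePoints_anti fun β => le_max_left _ _).trans (hf ⟨b, hb⟩)
    · exact closurePoints_anti (fun β => (le_max_left _ _).trans (le_max_right _ _)) hδ
    · exact lt_of_mem_closurePoints (fun β => (le_max_right _ _).trans (le_max_right _ _)) hδ
  have hG : ∀ a : I, ∀ f : I → I, ∃ g : I → I, ∀ x ≤ a, x ∉ isolatedIndices y →
      y x ∈ closure (y '' (closurePoints f \ closurePoints g)) := by
    intro a f
    have h1 : ∀ x, ∃ g : I → I, x ∉ isolatedIndices y →
        y x ∈ closure (y '' (closurePoints f \ closurePoints g)) := by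
      intro x
      by_cases hx : x ∈ isolatedIndices y
      · exact ⟨id, fun h => absurd hx h⟩
      · simp only [isolatedIndices, mem_ofPred_eq, not_exists, not_forall, not_not] at hx
        obtain ⟨g, hg⟩ := hx f
        exact ⟨g, fun _ => hg⟩
    choose G hG using h1
    obtain ⟨g, hg⟩ := hI.exists_forall_closurePoints_subset (ι := Iic a) (hI.mk_Iic_lt a)
      fun x => G x.1
    exact ⟨g, fun x hx hxi => closure_mono
      (image_mono (sdiff_subset_sdiff_right (hg ⟨x, hx⟩))) (hG x hxi)⟩
  choose F hF1 hF2 using hF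
  choose G hG using hG
  let g : I → I → I := (wellFounded_lt (α := I)).fix fun a ih => G a (F a ih)
  have hg : ∀ a, g a = G a (F a fun b _ => g b) := fun a => WellFounded.fix_eq _ _ a
  refine ⟨fun a => F a fun b _ => g b, g, fun a b hab => hF1 b _ a hab, fun a => hF2 a _,
    fun a x hx hxi => ?_⟩
  rw [hg a]
  exact hG a _ x hx hxi

/-- Each piece gets a single colour, and each colour recurs cofinally. The point `z` does not depend
on `a`, so in the singular case the tail can later be moved off a small set. -/
theorem IsLeftSeparated.exists_hasDenseColoring [WellFoundedLT I] {y : I → X}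
    (hy : IsLeftSeparated y) (hI : IsRegularIndex I) (hX : ¬ HasDiscreteSubsetOfCard X #I) :
    ∃ z, ∀ a, ∃ J ⊆ y '' Ioi a, HasDenseColoring #I J ∧ y z ∈ closure J := by
  classical
  obtain ⟨h, hh⟩ := hy.exists_closurePoints_disjoint_isolatedIndices hI hX
  obtain ⟨f, g, hfg, hf, hlim⟩ := hI.exists_seq_closurePoints y h
  have hne : Nonempty I := mk_ne_zero_iff.1 (aleph0_pos.trans hI.aleph0_lt).ne'
  obtain ⟨z, hz, -⟩ := hI.exists_mem_closurePoints h (Classical.arbitrary I)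
  -- a colouring of the indices with unbounded colour classes
  obtain ⟨e⟩ : Nonempty (I ≃ (#I).ord.ToType × I) := by
    rw [← Cardinal.eq, mk_prod, mk_ord_toType]
    simp [mul_eq_self hI.aleph0_lt.le]
  let col : I → Ordinal.{u} := fun a => ((e a).1 : Ordinal)
  have hcol : ∀ ξ < (#I).ord, ∀ b, ∃ a, b < a ∧ col a = ξ := by
    intro ξ hξ b
    let i : (#I).ord.ToType := Ordinal.ToType.mk ⟨ξ, hξ⟩
    have h1 : #(range fun a => e.symm (i, a)) = #I :=
      mk_range_eq _ fun a b hab => (Prod.mk.inj (e.symm.injective hab)).2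
    obtain ⟨_, ⟨a, rfl⟩, ha⟩ := hI.exists_mem_gt_of_mk_eq h1 b
    refine ⟨_, ha, ?_⟩
    simp [col, i]
  let W : I → Set X := fun a => y '' (closurePoints (f a) \ closurePoints (g a))
  have hWdis : ∀ a b, a < b → Disjoint (W a) (W b) := by
    intro a b hab
    rw [disjoint_image_iff hy.injective, disjoint_left]
    exact fun x hx hx' => hx.2 (hfg a b hab hx'.1)
  have hW : ∀ a b x, x ∈ W a → x ∈ W b → a = b := by
    intro a b x ha hb
    rcases lt_trichotomy a b with h | h | h
    · exact absurd hb (disjoint_left.1 (hWdis a b h) ha)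
    · exact h
    · exact absurd ha (disjoint_left.1 (hWdis b a h) hb)
  let c : X → Ordinal.{u} := fun x => if hx : ∃ a, x ∈ W a then col hx.choose else 0
  have hc : ∀ a, ∀ x ∈ W a, c x = col a := by
    intro a x hx
    have hex : ∃ a, x ∈ W a := ⟨a, hx⟩
    simp only [c, dif_pos hex]
    rw [hW _ _ _ hex.choose_spec hx]
  refine ⟨z, fun a => ⟨⋃ b ∈ Ioi a, W b, ?_, ⟨c, fun ξ hξ p hp => ?_⟩, ?_⟩⟩
  · refine iUnion₂_subset fun b hb => image_mono fun x hx => ?_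
    exact hb.trans (hf b hx.1).2
  · obtain ⟨b, hb, x, hx, rfl⟩ := mem_iUnion₂.1 hp
    obtain ⟨b', hb', hcb'⟩ := hcol ξ hξ (max a x)
    -- The index `x` lies in the club of `h`, hence is not isolated, and `b'` is past `x`.
    have h2 := hlim b' x ((le_max_right _ _).trans hb'.le) (hh x (hf b hx.1).1)
    have h3 : W b' ⊆ (⋃ b ∈ Ioi a, W b) ∩ c ⁻¹' {ξ} := fun q hq =>
      ⟨mem_iUnion₂.2 ⟨b', (le_max_left _ _).trans_lt hb', hq⟩, (hc b' q hq).trans hcb'⟩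
    exact closure_mono h3 h2
  · obtain ⟨b, hb, -⟩ := hcol 0 (by
      rw [lt_ord, Ordinal.card_zero]; exact aleph0_pos.trans hI.aleph0_lt) (max a z)
    exact closure_mono (subset_biUnion_of_mem (u := W) ((le_max_left _ _).trans_lt hb))
      (hlim b z ((le_max_right _ _).trans hb.le) (hh z hz))

end LeftSeparated

/-! ### Small dense subsets and the regular case -/

section DenseSubsets

open Set

theorem mk_iUnion_lt_of_lt {X : Type u} {κ μ : Cardinal.{u}} (hμ : ℵ₀ ≤ μ) (hκ : κ < μ) (ι : Type u)
    (D : ι → Set X) (hι : #ι < μ) (hD : ∀ i, #(D i) < κ) : #(⋃ i, D i) < μ :=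
  (mk_iUnion_le D).trans_lt ((mul_le_mul_right (ciSup_le' fun i => (hD i).le) _).trans_lt
    (mul_lt_of_lt hμ hι hκ))

variable {X : Type u} [TopologicalSpace X]

/-- Greedily pick points outside the closure of the earlier ones; only a small dense subset can stop
this. -/
theorem exists_isLeftSeparated_or_exists_mk_lt (κ : Cardinal.{u}) (S : Set X) :
    (∃ y : κ.ord.ToType → X, range y ⊆ S ∧ IsLeftSeparated y) ∨
      ∃ D ⊆ S, #D < κ ∧ S ⊆ closure D := by
  classical
  rw [or_iff_not_imp_right]
  intro h
  push Not at h
  rcases isEmpty_or_nonempty κ.ord.ToType with hE | ⟨⟨i⟩⟩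
  · exact ⟨isEmptyElim, range_subset_iff.2 fun a => isEmptyElim a, fun a => isEmptyElim a⟩
  have hlt : ∀ a : κ.ord.ToType, #(Iio a) < κ := fun a => by
    simpa using mk_Iio_lt a (by simp)
  have hne : Nonempty X := by
    obtain ⟨x, -, -⟩ := not_subset.1
      (h ∅ (empty_subset _) (by simpa using pos_of_gt (hlt i)))
    exact ⟨x⟩
  have hex : ∀ D : Set X, ∃ x, D ⊆ S → #D < κ → x ∈ S ∧ x ∉ closure D := by
    intro D
    by_cases hD : D ⊆ S ∧ #D < κ
    · obtain ⟨x, hx⟩ := not_subset.1 (h D hD.1 hD.2)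
      exact ⟨x, fun _ _ => hx⟩
    · exact ⟨Classical.arbitrary X, fun h1 h2 => absurd ⟨h1, h2⟩ hD⟩
  choose pick hpick using hex
  let y : κ.ord.ToType → X := (wellFounded_lt (α := κ.ord.ToType)).fix
    fun a ih => pick (range fun b : Iio a => ih b.1 b.2)
  have hy : ∀ a, y a = pick (y '' Iio a) := fun a => by
    rw [image_eq_range]
    exact WellFounded.fix_eq _ _ a
  have hcard : ∀ a, #(y '' Iio a) < κ := fun a => mk_image_le.trans_lt (hlt a)
  have hS : ∀ a, y a ∈ S := by
    intro a
    induction a using WellFoundedLT.induction with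
    | ind a ih =>
      rw [hy a]
      exact (hpick _ (image_subset_iff.2 fun b hb => ih b hb) (hcard a)).1
  refine ⟨y, range_subset_iff.2 hS, fun a => ?_⟩
  have := (hpick (y '' Iio a) (image_subset_iff.2 fun b _ => hS b) (hcard a)).2
  rwa [← hy a] at this

/-- Recursion of length `μ`, each new dense set avoiding all earlier ones; `hU` keeps their union
below `μ`. It applies with `κ = μ` regular, and with `κ < μ` for `μ` singular. -/
theorem hasDenseColoring_of_forall_exists {κ μ : Cardinal.{u}} {G : Set X}
    (hG : ∀ A : Set X, #A < μ → ∃ D ⊆ G \ A, #D < κ ∧ G ⊆ closure D)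
    (hU : ∀ (ι : Type u) (D : ι → Set X), #ι < μ → (∀ i, #(D i) < κ) → #(⋃ i, D i) < μ) :
    HasDenseColoring μ G := by
  classical
  choose! f hf using hG
  let D : μ.ord.ToType → Set X := (wellFounded_lt (α := μ.ord.ToType)).fix
    fun a ih => f (⋃ b : Iio a, ih b.1 b.2)
  have hD : ∀ a, D a = f (⋃ b : Iio a, D b) := fun a => WellFounded.fix_eq _ _ a
  have hlt : ∀ a : μ.ord.ToType, #(Iio a) < μ := fun a => by
    simpa using mk_Iio_lt a (by simp)
  have hcard : ∀ a, #(D a) < κ := by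
    intro a
    induction a using WellFoundedLT.induction with
    | ind a ih =>
      rw [hD a]
      exact (hf _ (hU _ _ (hlt a) fun b => ih b.1 b.2)).2.1
  have hD' : ∀ a, D a ⊆ G \ (⋃ b : Iio a, D b) ∧ G ⊆ closure (D a) := fun a => by
    have := hf _ (hU _ _ (hlt a) fun b => hcard b.1)
    rw [← hD a] at this
    exact ⟨this.1, this.2.2⟩
  have hdis : ∀ a b x, x ∈ D a → x ∈ D b → a = b := by
    have key : ∀ a b x, a < b → x ∈ D a → x ∉ D b := fun a b x hab ha hb =>
      ((hD' b).1 hb).2 (mem_iUnion.2 ⟨⟨a, hab⟩, ha⟩)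
    intro a b x ha hb
    rcases lt_trichotomy a b with h | h | h
    · exact absurd hb (key a b x h ha)
    · exact h
    · exact absurd ha (key b a x h hb)
  refine ⟨fun x => if hx : ∃ a, x ∈ D a then (hx.choose : Ordinal) else 0, fun ξ hξ => ?_⟩
  let a : μ.ord.ToType := Ordinal.ToType.mk ⟨ξ, hξ⟩
  refine (hD' a).2.trans (closure_mono fun x hx => ⟨((hD' a).1 hx).1, ?_⟩)
  have hex : ∃ a, x ∈ D a := ⟨a, hx⟩
  rw [mem_preimage, mem_singleton_iff, dif_pos hex, hdis _ _ _ hex.choose_spec hx]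
  simp [a]

theorem subset_closure_diff_of_forall_le_mk {μ : Cardinal.{u}} {G A : Set X} (hGo : IsOpen G)
    (hG : ∀ U ⊆ G, IsOpen U → U.Nonempty → μ ≤ #U) (hA : #A < μ) : G ⊆ closure (G \ A) := by
  refine fun x hx => mem_closure_iff.2 fun U hU hxU => ?_
  have h1 := hG (U ∩ G) inter_subset_right (hU.inter hGo) ⟨x, hxU, hx⟩
  obtain ⟨z, hz, hzA⟩ := not_subset.1 fun h : U ∩ G ⊆ A =>
    ((mk_le_mk_of_subset h).trans_lt hA).not_ge h1
  exact ⟨z, hz.1, hz.2, hzA⟩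

theorem exists_hasDenseColoring_of_isRegular {κ : Cardinal.{u}} (hκ : κ.IsRegular) (hω : ℵ₀ < κ)
    (hX : ¬ HasDiscreteSubsetOfCard X κ) {G : Set X} (hGo : IsOpen G) (hne : G.Nonempty)
    (hG : ∀ U ⊆ G, IsOpen U → U.Nonempty → κ ≤ #U) :
    ∃ S ⊆ G, S.Nonempty ∧ HasDenseColoring κ S := by
  by_cases h : ∃ y : κ.ord.ToType → X, range y ⊆ G ∧ IsLeftSeparated y
  · obtain ⟨y, hyG, hy⟩ := h
    obtain ⟨z, hz⟩ := hy.exists_hasDenseColoring (hκ.isRegularIndex hω) (by rwa [mk_ord_toType])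
    obtain ⟨J, hJ, hJc, hzJ⟩ := hz z
    rw [mk_ord_toType] at hJc
    exact ⟨J, (hJ.trans (image_subset_range _ _)).trans hyG, closure_nonempty_iff.1 ⟨_, hzJ⟩, hJc⟩
  · refine ⟨G, subset_rfl, hne, hasDenseColoring_of_forall_exists (κ := κ) (fun A hA => ?_)
      fun ι D hι hD => (card_iUnion_lt_iff_forall_of_isRegular hκ hι).2 hD⟩
    rcases exists_isLeftSeparated_or_exists_mk_lt κ (G \ A) with ⟨y, hyG, hy⟩ | ⟨D, hD, hDc, hGD⟩
    · exact absurd ⟨y, hyG.trans sdiff_subset, hy⟩ h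
    · exact ⟨D, hD, hDc, (subset_closure_diff_of_forall_le_mk hGo hG hA).trans
        (closure_minimal hGD isClosed_closure)⟩

theorem HasDiscreteSubsetOfCard.mono {κ μ : Cardinal.{u}} (h : HasDiscreteSubsetOfCard X κ)
    (hμ : μ ≤ κ) : HasDiscreteSubsetOfCard X μ := by
  obtain ⟨S, hS, rfl⟩ := h
  obtain ⟨T, hT, rfl⟩ := le_mk_iff_exists_subset.1 hμ
  exact ⟨T, hS.mono hT, rfl⟩

theorem not_hasDiscreteSubsetOfCard_of_mk_lt {κ : Cardinal.{u}} (h : #X < κ) :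
    ¬ HasDiscreteSubsetOfCard X κ := by
  rintro ⟨S, -, rfl⟩
  exact (mk_set_le S).not_gt h

theorem spreadHat_spec (X : Type u) [TopologicalSpace X] :
    ℵ₀ < spreadHat X ∧ ¬ HasDiscreteSubsetOfCard X (spreadHat X) := by
  have hne : {μ : Cardinal.{u} | ℵ₀ < μ ∧ ¬ HasDiscreteSubsetOfCard X μ}.Nonempty :=
    ⟨Order.succ (max ℵ₀ #X), Order.lt_succ_of_le (le_max_left _ _),
      not_hasDiscreteSubsetOfCard_of_mk_lt (Order.lt_succ_of_le (le_max_right _ _))⟩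
  exact csInf_mem hne

theorem regularSpread_spec (X : Type u) [TopologicalSpace X] :
    ℵ₀ < regularSpread X ∧ (regularSpread X).IsRegular ∧
      ¬ HasDiscreteSubsetOfCard X (regularSpread X) := by
  have hne : {μ : Cardinal.{u} | ℵ₀ < μ ∧ μ.IsRegular ∧
      ¬ HasDiscreteSubsetOfCard X μ}.Nonempty :=
    ⟨Order.succ (max ℵ₀ #X), Order.lt_succ_of_le (le_max_left _ _),
      isRegular_succ (le_max_left _ _),
      not_hasDiscreteSubsetOfCard_of_mk_lt (Order.lt_succ_of_le (le_max_right _ _))⟩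
  exact csInf_mem hne

theorem dispersionCharacter_le {G : Set X} (hG : IsOpen G) (hne : G.Nonempty) :
    dispersionCharacter X ≤ #G :=
  csInf_le' ⟨G, hG, hne, rfl⟩

theorem nonempty_of_dispersionCharacter_pos (h : 0 < dispersionCharacter X) : Nonempty X := by
  by_contra hX
  rw [not_nonempty_iff] at hX
  refine h.ne' ?_
  have : {μ : Cardinal.{u} | ∃ G : Set X, IsOpen G ∧ G.Nonempty ∧ #G = μ} = ∅ :=
    eq_empty_of_forall_notMem fun μ ⟨G, _, ⟨x, _⟩, _⟩ => hX.elim x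
  rw [dispersionCharacter, this, Cardinal.sInf_empty]

theorem isResolvable_of_isRegular {κ : Cardinal.{u}} (hκ : κ.IsRegular) (hω : ℵ₀ < κ)
    (hX : ¬ HasDiscreteSubsetOfCard X κ) (hΔ : κ ≤ dispersionCharacter X) : IsResolvable κ X := by
  have := nonempty_of_dispersionCharacter_pos (hκ.pos.trans_le hΔ)
  exact (HasDenseColoring.univ_of_forall_isOpen fun G hG hne =>
    exists_hasDenseColoring_of_isRegular hκ hω hX hG hne fun U _ hU hUne =>
      hΔ.trans (dispersionCharacter_le hU hUne)).isResolvable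

end DenseSubsets

/-! ### Cofinal sequences and obstructed points -/

section Singular

open Set

/-- The rank lets stage `j` of the singular construction treat only `σ j` points while every point
is eventually reached. -/
theorem exists_rank_mk_le {Y : Type u} (S : Set Y) :
    ∃ r : Y → Ordinal.{u}, (∀ x ∈ S, r x < (#S).ord) ∧
      ∀ σ : Cardinal.{u}, #{x | x ∈ S ∧ r x < σ.ord} ≤ σ := by
  classical
  obtain ⟨e⟩ : Nonempty (S ≃ (#S).ord.ToType) := by rw [← Cardinal.eq, mk_ord_toType]
  let r : Y → Ordinal.{u} := fun x => if h : x ∈ S then (e ⟨x, h⟩ : Ordinal) else 0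
  have hr : ∀ (x) (h : x ∈ S), r x = (e ⟨x, h⟩ : Ordinal) := fun x h => dif_pos h
  refine ⟨r, fun x hx => ?_, fun σ => ?_⟩
  · rw [hr x hx]
    exact (e ⟨x, hx⟩).toOrd.2
  · have : #{x | x ∈ S ∧ r x < σ.ord} ≤ #σ.ord.ToType := by
      refine mk_le_of_injective
        (f := fun x => Ordinal.ToType.mk ⟨r x.1, x.2.2⟩) fun x x' hxx' => ?_
      have h1 : r x.1 = r x'.1 := Subtype.mk.inj (Ordinal.ToType.mk.injective hxx')
      rw [hr _ x.2.1, hr _ x'.2.1] at h1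
      have h2 := e.injective (Ordinal.ToType.mk.symm.injective (Subtype.ext h1))
      exact Subtype.ext (Subtype.mk.inj h2)
    rwa [mk_ord_toType] at this

theorem Cardinal.IsSingular.exists_cofinal_seq {μ b : Cardinal.{u}} (hμ : μ.IsSingular)
    (hb : b < μ) :
    ∃ σ : μ.ord.cof.ord.ToType → Cardinal.{u}, (∀ j, σ j < μ) ∧
      (∀ j, Order.succ (max b (⨆ i : Iio j, σ i)) ≤ σ j) ∧ ∀ ρ < μ, ∃ j, ρ ≤ σ j := by
  obtain ⟨s, hs, hsc⟩ := Order.exists_cof_eq μ.ord.ToType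
  rw [Ordinal.cof_toType] at hsc
  obtain ⟨e⟩ : Nonempty (μ.ord.cof.ord.ToType ≃ s) := by rw [← Cardinal.eq, mk_ord_toType, hsc]
  let c : μ.ord.cof.ord.ToType → Cardinal.{u} := fun j => ((e j).1 : Ordinal).card
  let σ : μ.ord.cof.ord.ToType → Cardinal.{u} :=
    (wellFounded_lt (α := μ.ord.cof.ord.ToType)).fix
      fun j ih => max (c j) (Order.succ (max b (⨆ i : Iio j, ih i.1 i.2)))
  have hσ : ∀ j, σ j = max (c j) (Order.succ (max b (⨆ i : Iio j, σ i))) :=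
    fun j => WellFounded.fix_eq _ _ j
  refine ⟨σ, fun j => ?_, fun j => ?_, fun ρ hρ => ?_⟩
  · induction j using WellFoundedLT.induction with
    | ind j ih =>
      rw [hσ j]
      refine max_lt (lt_ord.1 (e j).1.toOrd.2) (hμ.isSuccLimit.succ_lt (max_lt hb ?_))
      -- Fewer than `cof μ` earlier values have supremum below `μ`.
      refine iSup_lt_of_lt_cof_ord ?_ fun i => ih i.1 i.2
      simpa using mk_Iio_lt j (by simp)
  · rw [hσ j]
    exact le_max_right _ _
  · obtain ⟨t, hts, ht⟩ := hs (Ordinal.ToType.mk ⟨ρ.ord, ord_lt_ord.2 hρ⟩)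
    refine ⟨e.symm ⟨t, hts⟩, ?_⟩
    rw [hσ]
    refine le_max_of_le_left ?_
    simp only [c, Equiv.apply_symm_apply]
    rw [← ord_le]
    rw [← OrderIso.le_symm_apply] at ht
    exact ht

variable {X : Type u} [TopologicalSpace X]

/-- The points of `G` that some set `A` of at most `ν` points separates from all small
`ν⁺`-resolvable subsets of `G \ A`. -/
def obstructedPoints (G : Set X) (ν : Cardinal.{u}) : Set X :=
  {z | ∃ A : Set X, #A ≤ ν ∧ ∀ J ⊆ G \ A, #J ≤ Order.succ ν →
    HasDenseColoring (Order.succ ν) J → z ∉ closure J}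

/-- Otherwise `S` contains a left separated `ν⁺`-sequence. The set `A` obstructing its term `y z`
meets only boundedly many terms, so a coloured tail accumulating at `y z` avoids `A`. -/
theorem exists_dense_subset_of_subset_obstructedPoints {G S : Set X} {ν : Cardinal.{u}}
    (hν : ℵ₀ ≤ ν) (hX : ¬ HasDiscreteSubsetOfCard X ν) (hSG : S ⊆ G)
    (hS : S ⊆ obstructedPoints G ν) : ∃ D ⊆ S, #D ≤ ν ∧ S ⊆ closure D := by
  rcases exists_isLeftSeparated_or_exists_mk_lt (Order.succ ν) S with ⟨y, hyS, hy⟩ | ⟨D, h1, h2, h3⟩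
  · exfalso
    have hI := (isRegular_succ hν).isRegularIndex (Order.lt_succ_of_le hν)
    obtain ⟨z, hz⟩ := hy.exists_hasDenseColoring hI
      (by rw [mk_ord_toType]; exact fun h => hX (h.mono (Order.le_succ ν)))
    obtain ⟨A, hA, hAz⟩ := hS (hyS (mem_range_self z))
    obtain ⟨a, ha⟩ := hI.exists_gt (y ⁻¹' A) (by
      rw [mk_ord_toType]
      exact (mk_preimage_of_injective y A hy.injective).trans_lt (Order.lt_succ_of_le hA))
    obtain ⟨J, hJ, hJc, hzJ⟩ := hz a
    rw [mk_ord_toType] at hJc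
    refine hAz J (fun x hx => ?_) ?_ hJc hzJ
    · obtain ⟨i, hi, rfl⟩ := hJ hx
      exact ⟨hSG (hyS (mem_range_self i)), fun hiA => (ha i hiA).not_gt hi⟩
    · refine (mk_le_mk_of_subset (hJ.trans (image_subset_range _ _))).trans ?_
      simpa using mk_range_le (f := y)
  · exact ⟨D, h1, Order.lt_succ_iff.1 h2, h3⟩

/-- Removing fewer than `μ` points leaves a dense part of `U`, split into at most `ρ` pieces with
dense subsets of size at most `ρ`. -/
theorem hasDenseColoring_of_subset_iUnion_obstructedPoints {μ ρ : Cardinal.{u}} {G U : Set X}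
    (hμ : ℵ₀ ≤ μ) (hUo : IsOpen U) (hUG : U ⊆ G)
    (hG : ∀ V ⊆ G, IsOpen V → V.Nonempty → μ ≤ #V) {ι : Type u} (ν : ι → Cardinal.{u})
    (hν : ∀ i, ℵ₀ ≤ ν i) (hX : ∀ i, ¬ HasDiscreteSubsetOfCard X (ν i)) (hρ : Order.succ ρ < μ)
    (hρω : ℵ₀ ≤ ρ) (hι : #ι ≤ ρ) (hνρ : ∀ i, ν i ≤ ρ)
    (hU : U ⊆ ⋃ i, obstructedPoints G (ν i)) : HasDenseColoring μ U := by
  refine hasDenseColoring_of_forall_exists (κ := Order.succ ρ) (fun A hA => ?_)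
    (mk_iUnion_lt_of_lt hμ hρ)
  have h1 : ∀ i, ∃ D ⊆ (U \ A) ∩ obstructedPoints G (ν i), #D ≤ ν i ∧
      (U \ A) ∩ obstructedPoints G (ν i) ⊆ closure D := fun i =>
    exists_dense_subset_of_subset_obstructedPoints (hν i) (hX i)
      (inter_subset_left.trans (sdiff_subset.trans hUG)) inter_subset_right
  choose D hD1 hD2 hD3 using h1
  refine ⟨⋃ i, D i, iUnion_subset fun i => (hD1 i).trans inter_subset_left, ?_, ?_⟩
  · refine Order.lt_succ_of_le ((mk_iUnion_le D).trans ?_)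
    refine (mul_le_mul' hι (ciSup_le' fun i => (hD2 i).trans (hνρ i))).trans ?_
    rw [mul_eq_self hρω]
  · refine (subset_closure_diff_of_forall_le_mk hUo (fun V hV => hG V (hV.trans hUG)) hA).trans
      (closure_minimal (fun x hx => ?_) isClosed_closure)
    obtain ⟨i, hi⟩ := mem_iUnion.1 (hU hx.1)
    exact closure_mono (subset_iUnion D i) (hD3 i ⟨hx, hi⟩)

end Singular

/-! ### The singular case and the conclusion -/

section SingularResolution

open Set

variable {X : Type u} [TopologicalSpace X]

/-- If disjoint sets `K j` carry dense colourings by more and more colours, and every nonempty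
open subset of `G` meets `K j` for arbitrarily large `j`, then the union has a dense colouring. -/
theorem hasDenseColoring_iUnion_of_cofinal {I : Type u} {μ : Cardinal.{u}} {G : Set X}
    (hGo : IsOpen G) {K : I → Set X} {ν : I → Cardinal.{u}} (hKG : ∀ j, K j ⊆ G)
    (hdis : Pairwise fun i j => Disjoint (K i) (K j)) (hK : ∀ j, HasDenseColoring (ν j) (K j))
    (htail : ∀ V ⊆ G, IsOpen V → V.Nonempty → ∀ ρ < μ, ∃ j, ρ < ν j ∧ (V ∩ K j).Nonempty) :
    HasDenseColoring μ (⋃ j, K j) := by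
  classical
  choose c hc using hK
  refine ⟨fun x => if hx : ∃ j, x ∈ K j then c hx.choose x else 0, fun ξ hξ x hx => ?_⟩
  refine mem_closure_iff.2 fun U hU hxU => ?_
  obtain ⟨j₀, hj₀⟩ := mem_iUnion.1 hx
  -- Once `ν j` exceeds `ξ.card`, the colour `ξ` is used densely in `K j`.
  obtain ⟨j, hj, p, ⟨hpU, -⟩, hpK⟩ := htail (U ∩ G) inter_subset_right (hU.inter hGo)
    ⟨x, hxU, hKG j₀ hj₀⟩ ξ.card (lt_ord.1 hξ)
  obtain ⟨q, hqU, hqK, hqc⟩ := mem_closure_iff.1 (hc j ξ (lt_ord.2 hj) hpK) U hU hpU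
  have hex : ∃ j, q ∈ K j := ⟨j, hqK⟩
  have hj' : hex.choose = j := by
    by_contra hne
    exact disjoint_left.1 (hdis hne) hex.choose_spec hqK
  refine ⟨q, hqU, mem_iUnion.2 ⟨j, hqK⟩, ?_⟩
  rw [mem_preimage, dif_pos hex, hj']
  exact hqc

/-- The earlier sets have at most `ν j` points altogether, so each unobstructed point of `T j` is a
limit of a small coloured set avoiding them. -/
theorem exists_seq_hasDenseColoring {I : Type u} [LinearOrder I] [WellFoundedLT I] (G : Set X)
    {ν σ : I → Cardinal.{u}} {T : I → Set X} (hω : ∀ j, ℵ₀ ≤ ν j) (hνσ : ∀ j, Order.succ (ν j) ≤ σ j)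
    (hσν : ∀ i j, i < j → σ i ≤ ν j) (hI : ∀ j, #I ≤ ν j) (hT : ∀ j, #(T j) ≤ σ j)
    (hTν : ∀ j, ∀ z ∈ T j, z ∉ obstructedPoints G (ν j)) :
    ∃ K : I → Set X, (∀ j, K j ⊆ G) ∧ (Pairwise fun i j => Disjoint (K i) (K j)) ∧
      (∀ j, HasDenseColoring (Order.succ (ν j)) (K j)) ∧ ∀ j, T j ⊆ closure (K j) := by
  classical
  have hJ : ∀ (j : I) (A : Set X) (z : X), ∃ J ⊆ G \ A, #J ≤ Order.succ (ν j) ∧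
      HasDenseColoring (Order.succ (ν j)) J ∧ (z ∈ T j → #A ≤ ν j → z ∈ closure J) := by
    intro j A z
    by_cases h : z ∈ T j ∧ #A ≤ ν j
    · have h1 := hTν j z h.1
      simp only [obstructedPoints, mem_ofPred_eq, not_exists, not_and, not_forall, not_not] at h1
      obtain ⟨J, hJ1, hJ2, hJ3, hJ4⟩ := h1 A h.2
      exact ⟨J, hJ1, hJ2, hJ3, fun _ _ => hJ4⟩
    · exact ⟨∅, empty_subset _, by simp, hasDenseColoring_empty _, fun h1 h2 => absurd ⟨h1, h2⟩ h⟩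
  choose J hJG hJc hJd hJl using hJ
  let K : I → Set X := (wellFounded_lt (α := I)).fix
    fun j ih => ⋃ z : T j, J j (⋃ i : Iio j, ih i.1 i.2) z
  let A : I → Set X := fun j => ⋃ i : Iio j, K i
  have hK : ∀ j, K j = ⋃ z : T j, J j (A j) z := fun j => WellFounded.fix_eq _ _ j
  have hKG : ∀ j, K j ⊆ G \ A j := fun j => by
    rw [hK j]
    exact iUnion_subset fun z => hJG _ _ _
  have hσω : ∀ j, ℵ₀ ≤ σ j := fun j => (hω j).trans ((Order.le_succ _).trans (hνσ j))
  have hKc : ∀ j, #(K j) ≤ σ j := fun j => by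
    rw [hK j]
    refine (mk_iUnion_le _).trans ((mul_le_mul' (hT j) (ciSup_le' fun z =>
      (hJc _ _ _).trans (hνσ j))).trans ?_)
    rw [mul_eq_self (hσω j)]
  have hAc : ∀ j, #(A j) ≤ ν j := fun j => by
    refine (mk_iUnion_le _).trans ((mul_le_mul' ((mk_set_le _).trans (hI j)) (ciSup_le' fun i : Iio j =>
      (hKc i).trans (hσν i j i.2))).trans ?_)
    rw [mul_eq_self (hω j)]
  have hlt : ∀ i j, i < j → Disjoint (K i) (K j) := fun i j hij =>
    disjoint_left.2 fun x hxi hxj => (hKG j hxj).2 (mem_iUnion.2 ⟨⟨i, hij⟩, hxi⟩)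
  refine ⟨K, fun j => (hKG j).trans sdiff_subset, fun i j hij => ?_, fun j => ?_, fun j z hz => ?_⟩
  · rcases hij.lt_or_gt with h | h
    · exact hlt i j h
    · exact (hlt j i h).symm
  · rw [hK j]
    exact HasDenseColoring.iUnion fun z => hJd _ _ _
  · rw [hK j]
    exact closure_mono (subset_iUnion (fun z : T j => J j (A j) z) ⟨z, hz⟩)
      (hJl j (A j) z hz (hAc j))

theorem exists_hasDenseColoring_of_cofinal_seq {μ b : Cardinal.{u}} (hμ : Order.IsSuccLimit μ)
    (hμω : ℵ₀ ≤ μ) (hb : ℵ₀ ≤ b) (hX : ¬ HasDiscreteSubsetOfCard X b) {I : Type u} [LinearOrder I]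
    [WellFoundedLT I] (hI : #I ≤ b) {ν σ : I → Cardinal.{u}} (hσμ : ∀ j, σ j < μ)
    (hσ : ∀ ρ < μ, ∃ j, ρ ≤ σ j) (hbν : ∀ j, b ≤ ν j) (hνσ : ∀ j, Order.succ (ν j) ≤ σ j)
    (hσν : ∀ i j, i < j → σ i ≤ ν j)
    (hν : ∀ j ρ, b ≤ ρ → (∀ i < j, σ i ≤ ρ) → ν j ≤ ρ) {G : Set X}
    (hGo : IsOpen G) (hne : G.Nonempty) (hG : ∀ U ⊆ G, IsOpen U → U.Nonempty → μ ≤ #U)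
    (hGμ : #G ≤ μ) : ∃ S ⊆ G, S.Nonempty ∧ HasDenseColoring μ S := by
  by_contra! hno
  have hνσ' : ∀ j, ν j < σ j := fun j => Order.succ_le_iff.1 (hνσ j)
  have hω : ∀ j, ℵ₀ ≤ ν j := fun j => hb.trans (hbν j)
  have hσω : ∀ j, ℵ₀ ≤ σ j := fun j => (hω j).trans (hνσ' j).le
  have hXν : ∀ j, ¬ HasDiscreteSubsetOfCard X (ν j) := fun j h => hX (h.mono (hbν j))
  have hσmono : ∀ i j, i ≤ j → σ i ≤ σ j := fun i j hij => by
    rcases hij.eq_or_lt with rfl | h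
    · exact le_rfl
    · exact (hσν i j h).trans (hνσ' j).le
  -- dense subsets of the sets of points first obstructed at stage `j`
  let P : I → Set X := fun j =>
    {z | z ∈ G ∧ z ∈ obstructedPoints G (ν j) ∧ ∀ i < j, z ∉ obstructedPoints G (ν i)}
  have hZ : ∀ j, ∃ Z ⊆ P j, #Z ≤ ν j ∧ P j ⊆ closure Z := fun j =>
    exists_dense_subset_of_subset_obstructedPoints (hω j) (hXν j) (fun z hz => hz.1)
      fun z hz => hz.2.1
  choose Z hZP hZc hZd using hZ
  choose r hr hrc using fun j => exists_rank_mk_le (Z j)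
  obtain ⟨rG, hrG, hrGc⟩ := exists_rank_mk_le G
  -- The initial piece of `G` reaches points that are never obstructed; those of the `Z i` reach
  -- points first obstructed at a later stage `i`.
  let T : I → Set X := fun j =>
    ({z | z ∈ G ∧ rG z < (σ j).ord} ∪ ⋃ i, {z | z ∈ Z i ∧ r i z < (σ j).ord}) \
      obstructedPoints G (ν j)
  have hT : ∀ j, #(T j) ≤ σ j := fun j => by
    refine (mk_le_mk_of_subset sdiff_subset).trans ((mk_union_le _ _).trans ?_)
    refine add_le_of_le (hσω j) (hrGc _) ((mk_iUnion_le _).trans ?_)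
    refine (mul_le_mul' (hI.trans ((hbν j).trans (hνσ' j).le))
      (ciSup_le' fun i => hrc i (σ j))).trans ?_
    rw [mul_eq_self (hσω j)]
  obtain ⟨K, hKG, hKdis, hK, hTK⟩ := exists_seq_hasDenseColoring G hω hνσ hσν
    (fun j => hI.trans (hbν j)) hT fun j z hz => hz.2
  have hmeet : ∀ V : Set X, IsOpen V → ∀ j, ∀ z ∈ V, z ∈ T j → (V ∩ K j).Nonempty :=
    fun V hV j z hzV hzT => mem_closure_iff.1 (hTK j hzT) V hV hzV
  have htail : ∀ V ⊆ G, IsOpen V → V.Nonempty → ∀ j₀, ∃ j, j₀ ≤ j ∧ (V ∩ K j).Nonempty := by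
    intro V hVG hV hVne j₀
    have h1 : ¬ V ⊆ ⋃ i : Iic j₀, obstructedPoints G (ν i) := fun hsub =>
      hno V hVG hVne <| hasDenseColoring_of_subset_iUnion_obstructedPoints (ρ := σ j₀) hμω hV hVG
        hG (fun i : Iic j₀ => ν i) (fun i => hω i) (fun i => hXν i) (hμ.succ_lt (hσμ j₀))
        (hσω j₀) ((mk_set_le _).trans (hI.trans ((hbν j₀).trans (hνσ' j₀).le)))
        (fun i => (hνσ' i).le.trans (hσmono i j₀ i.2)) hsub
    obtain ⟨z, hzV, hz⟩ := not_subset.1 h1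
    have hz' : ∀ i ≤ j₀, z ∉ obstructedPoints G (ν i) := fun i hi h =>
      hz (mem_iUnion.2 ⟨⟨i, hi⟩, h⟩)
    by_cases hobs : ∃ i, z ∈ obstructedPoints G (ν i)
    · obtain ⟨i, hi, hmin⟩ := (wellFounded_lt (α := I)).has_min
        {i | z ∈ obstructedPoints G (ν i)} hobs
      have hj₀i : j₀ < i := not_le.1 fun h => hz' i h hi
      have hzP : z ∈ P i := ⟨hVG hzV, hi, fun k hk h => hmin k h hk⟩
      obtain ⟨w, hwV, hwZ⟩ := mem_closure_iff.1 (hZd i hzP) V hV hzV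
      have hw : (r i w).card < ν i := (lt_ord.1 (hr i w hwZ)).trans_le (hZc i)
      -- As `ν i` is the least bound of `b` and the earlier `σ k`, the rank of `w` falls below some
      -- `σ k` with `j₀ ≤ k < i`, where `w` is still unobstructed.
      have hex : ∃ k, j₀ ≤ k ∧ k < i ∧ r i w < (σ k).ord := by
        by_contra! hcon
        have hle : ∀ k, j₀ ≤ k → k < i → σ k ≤ (r i w).card := fun k h1 h2 =>
          ord_le.1 (hcon k h1 h2)
        refine (hν i _ ?_ fun k hk => ?_).not_gt hw
        · exact ((hbν j₀).trans (hνσ' j₀).le).trans (hle j₀ le_rfl hj₀i)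
        · exact (hσmono k _ (le_max_left k j₀)).trans
            (hle (max k j₀) (le_max_right _ _) (max_lt hk hj₀i))
      obtain ⟨k, hk, hki, hrk⟩ := hex
      exact ⟨k, hk, hmeet V hV k w hwV
        ⟨Or.inr (mem_iUnion.2 ⟨i, hwZ, hrk⟩), (hZP i hwZ).2.2 k hki⟩⟩
    · obtain ⟨j₁, hj₁⟩ := hσ _ ((lt_ord.1 (hrG z (hVG hzV))).trans_le hGμ |> hμ.succ_lt)
      have h2 : rG z < (σ (max j₀ j₁)).ord := lt_ord.2
        ((Order.succ_le_iff.1 hj₁).trans_le (hσmono _ _ (le_max_right _ _)))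
      exact ⟨max j₀ j₁, le_max_left _ _, hmeet V hV _ z hzV
        ⟨Or.inl ⟨hVG hzV, h2⟩, fun h => hobs ⟨_, h⟩⟩⟩
  obtain ⟨j₀, -⟩ := hσ 0 (aleph0_pos.trans_le hμω)
  obtain ⟨j₁, -, x, -, hx⟩ := htail G subset_rfl hGo hne j₀
  refine hno (⋃ j, K j) (iUnion_subset hKG) ⟨x, mem_iUnion.2 ⟨j₁, hx⟩⟩
    (hasDenseColoring_iUnion_of_cofinal hGo hKG hKdis hK fun V hVG hV hVne ρ hρ => ?_)
  obtain ⟨i, hi⟩ := hσ ρ hρ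
  obtain ⟨i', hi'⟩ := hσ _ (hμ.succ_lt (hσμ i))
  obtain ⟨j, hj, hjK⟩ := htail V hVG hV hVne i'
  have hij : i < j := not_le.1 fun h =>
    (Order.succ_le_iff.1 hi').not_ge ((hσmono i' j hj).trans (hσmono j i h))
  exact ⟨j, Order.lt_succ_of_le (hi.trans (hσν i j hij)), hjK⟩

theorem exists_hasDenseColoring_of_isSingular {μ b : Cardinal.{u}} (hμ : μ.IsSingular)
    (hb : ℵ₀ ≤ b) (hbμ : b < μ) (hX : ¬ HasDiscreteSubsetOfCard X b) {G : Set X}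
    (hGo : IsOpen G) (hne : G.Nonempty) (hG : ∀ U ⊆ G, IsOpen U → U.Nonempty → μ ≤ #U)
    (hGμ : #G ≤ μ) : ∃ S ⊆ G, S.Nonempty ∧ HasDenseColoring μ S := by
  obtain ⟨σ, hσμ, hνσ, hσ⟩ := hμ.exists_cofinal_seq (max_lt hbμ hμ.cof_ord_lt)
  -- Including `cof μ` in the base makes the number of stages at most every `ν j`.
  refine exists_hasDenseColoring_of_cofinal_seq (b := max b μ.ord.cof) hμ.isSuccLimit
    hμ.aleph0_le (hb.trans (le_max_left _ _)) (fun h => hX (h.mono (le_max_left _ _)))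
    (by rw [mk_ord_toType]; exact le_max_right _ _) hσμ hσ (fun j => le_max_left _ _) hνσ
    (fun i j hij => ?_) (fun j ρ hρ h => max_le hρ (ciSup_le' fun i => h i i.2)) hGo hne hG hGμ
  exact le_max_of_le_right (le_ciSup (f := fun i : Iio j => σ i) (bddAbove_of_small) ⟨i, hij⟩)

theorem isMaximallyResolvable_of_regularSpread_le
    (h : regularSpread X ≤ dispersionCharacter X) : IsMaximallyResolvable X := by
  obtain ⟨hω, hreg, hX⟩ := regularSpread_spec X
  have hΔω : ℵ₀ < dispersionCharacter X := hω.trans_le h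
  rcases isRegular_or_isSingular hΔω.le with hΔ | hΔ
  · exact isResolvable_of_isRegular hΔ hΔω (fun h' => hX (h'.mono h)) le_rfl
  have := nonempty_of_dispersionCharacter_pos (aleph0_pos.trans hΔω)
  refine (HasDenseColoring.univ_of_forall_isOpen fun H hH hne => ?_).isResolvable
  -- An open `G ⊆ H` of least size: either `#G = Δ(X)`, or the regular case applies in `G` to the
  -- successor of `Δ(X)`.
  obtain ⟨G, ⟨hGH, hGo, hGne⟩, hmin⟩ := (InvImage.wf (fun G : Set X => #G) Cardinal.lt_wf).has_min
    {G : Set X | G ⊆ H ∧ IsOpen G ∧ G.Nonempty} ⟨H, subset_rfl, hH, hne⟩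
  have hG : ∀ U ⊆ G, IsOpen U → U.Nonempty → #G ≤ #U := fun U hU hUo hUne =>
    not_lt.1 (hmin U ⟨hU.trans hGH, hUo, hUne⟩)
  have hΔG := dispersionCharacter_le hGo hGne
  suffices ∃ S ⊆ G, S.Nonempty ∧ HasDenseColoring (dispersionCharacter X) S by
    obtain ⟨S, hS, h⟩ := this
    exact ⟨S, hS.trans hGH, h⟩
  rcases hΔG.eq_or_lt with heq | hlt
  · exact exists_hasDenseColoring_of_isSingular hΔ hω.le
      (h.lt_of_ne fun he => hΔ.not_isRegular (he ▸ hreg)) hX hGo hGne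
      (fun U hU hUo hUne => dispersionCharacter_le hUo hUne) heq.ge
  · obtain ⟨S, hS, hSne, hSc⟩ := exists_hasDenseColoring_of_isRegular (isRegular_succ hΔω.le)
      (Order.lt_succ_of_le hΔω.le)
      (fun h' => hX (h'.mono (h.trans (Order.le_succ _)))) hGo hGne
      fun U hU hUo hUne => (Order.succ_le_of_lt hlt).trans (hG U hU hUo hUne)
    exact ⟨S, hS, hSne, hSc.mono (Order.le_succ _)⟩

theorem regularSpread_le_aleph_one (h : spread X ≤ ℵ₀) : regularSpread X ≤ ℵ₁ := by
  refine csInf_le' ⟨aleph0_lt_aleph_one, isRegular_aleph_one, fun h1 => ?_⟩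
  have hbdd : BddAbove {μ | HasDiscreteSubsetOfCard X μ} :=
    ⟨#X, fun μ hμ => not_lt.1 fun hlt => not_hasDiscreteSubsetOfCard_of_mk_lt hlt hμ⟩
  exact aleph0_lt_aleph_one.not_ge ((le_csSup hbdd h1).trans ((le_max_right _ _).trans h))

end SingularResolution

theorem mainTheorem1 (X : Type u) [TopologicalSpace X] :
    (∀ κ : Cardinal.{u}, κ.IsRegular →
      spreadHat X ≤ κ → κ ≤ dispersionCharacter X → IsResolvable κ X) ∧
    (regularSpread X ≤ dispersionCharacter X → IsMaximallyResolvable X) ∧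
    (spread X ≤ ℵ₀ → ℵ₀ < dispersionCharacter X → IsMaximallyResolvable X) := by
  refine ⟨fun κ hκ hs hΔ => ?_, isMaximallyResolvable_of_regularSpread_le, fun hs hΔ => ?_⟩
  · obtain ⟨hω, hX⟩ := spreadHat_spec X
    exact isResolvable_of_isRegular hκ (hω.trans_le hs) (fun h => hX (h.mono hs)) hΔ
  · refine isMaximallyResolvable_of_regularSpread_le ((regularSpread_le_aleph_one hs).trans ?_)
    rw [← succ_aleph0]
    exact Order.succ_le_of_lt hΔ
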